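/- Let $\sigma_1,\sigma_2,\sigma_3$ be the Pauli matrices and, for $0\le\eta\le 1$, let $M'_{0|x}(\eta)=\tfrac12(\mathbb 1+\eta\sigma_x)$, $M'_{1|x}(\eta)=\mathbb 1-M'_{0|x}(\eta)$ ($x=1,2,3$) be the noisy Pauli POVMs on $\mathbb C^2$. For real coefficients $\gamma_{xy},\alpha_x,\beta_y$ ($x=1,2,3$, $y=1,\dots,n$, $n$ arbitrary) consider the Bell expression $$I=\sum_{x=1}^3\sum_{y=1}^n\gamma_{xy}\langle A_xB_y\rangle+\sum_{x=1}^3\alpha_x\langle A_x\rangle+\sum_{y=1}^n\beta_y\langle B_y\rangle ,$$ where $\langle A_xB_y\rangle=p(a=b|xy)-p(a\ne b|xy)$, $\langle A_x\rangle=p(0|x)-p(1|x)$, $\langle B_y\rangle=p(0|y)-p(1|y)$ and $a,b\in\{0,1\}$. Call $I\le 1$ a Bell inequality if it holds for all local distributions $p(ab|xy)=\sum_\lambda\pi(\lambda)p(a|x,\lambda)p(b|y,\lambda)$. Alice's POVMs $M_{a|x}$ can violate it if, for some finite-dimensional system of Bob, some shared state $\rho_{AB}$ and some two-outcome POVMs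 $M_{b|y}$ of Bob, the distribution $p(ab|xy)=\operatorname{tr}(\rho_{AB}\,M_{a|x}\otimes M_{b|y})$ gives $I>1$. Let $I_{\mathbb C^2}$ be the maximal value of $I$ over all states on $\mathbb C^2\otimes\mathbb C^2$ and all two-outcome POVMs of Alice and Bob on $\mathbb C^2$. Let $K_3$ be the Grothendieck constant of order 3, that is, the supremum of $\sum_{i,j}c_{ij}\langle u_i,v_j\rangle$ over unit vectors $u_i,v_j\in\mathbb R^3$ and real matrices $c$ of any size with $\sum_{i,j}c_{ij}s_it_j\le 1$ for all signs $s_i,t_j\in\{\pm1\}$. (1) Let $0\le\eta<1$ and let $I\le1$ be a Bell inequality of the above form, for any number $n$ of settings of Bob. If $\eta I_{\mathbb C^2}\le 1$ and $$\sum_y|\beta_y|\le\frac{1-\eta I_{\mathbb C^2}}{1-\eta},$$ then the POVMs $M'_{a|x}(\eta)$ cannot violate $I\le 1$. (2) Let $1/\sqrt3<\eta$, and let $\eta<1/K_3$ or $\eta<1/1.5163\simeq0.6595$. Then the POVMs $M'_{a|x}(\eta)$ form a hollow triangle: any two of them are jointly measurable, but the three are not jointly measurable (they are incompatible). They cannot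 violate any full-correlation Bell inequality (XOR game), i.e. any Bell inequality of the above form with all $\alpha_x=0$ and all $\beta_y=0$, for any $n$. -/

import Mathlib

open scoped Matrix Kronecker ComplexOrder

noncomputable section

namespace HollowTriangle

/-! ### Quantum states and measurements on finite-dimensional systems -/

/-- Density matrices: positive semidefinite of unit trace. -/
def IsState {ι : Type*} [Fintype ι] (ρ : Matrix ι ι ℂ) : Prop :=
  ρ.PosSemidef ∧ ρ.trace = 1

/-- A POVM with outcomes in `O`: positive semidefinite effects that sum to the identity. -/
def IsPOVM {O ι : Type*} [Fintype O] [Fintype ι] [DecidableEq ι]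
    (M : O → Matrix ι ι ℂ) : Prop :=
  (∀ a, (M a).PosSemidef) ∧ ∑ a, M a = 1

/-- Joint measurability of a family `M x a` (setting `x`, outcome `a`): there is a mother
observable, indexed by the lists `f` of outcomes of all settings, which is a POVM and whose
marginal over all outcomes except that of `x` is `M x`. -/
def JointlyMeasurable {X O ι : Type*} [Fintype X] [DecidableEq X] [Fintype O] [DecidableEq O]
    [Fintype ι] [DecidableEq ι] (M : X → O → Matrix ι ι ℂ) : Prop :=
  ∃ G : (X → O) → Matrix ι ι ℂ, IsPOVM G ∧
    ∀ x a, ∑ f ∈ Finset.univ.filter (fun f : X → O => f x = a), G f = M x a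

/-- The Pauli matrices `σ₁, σ₂, σ₃`. -/
def pauli : Fin 3 → Matrix (Fin 2) (Fin 2) ℂ :=
  ![!![0, 1; 1, 0], !![0, -Complex.I; Complex.I, 0], !![1, 0; 0, -1]]

/-- The noisy Pauli measurements: `M 0|x = (1 + η σ_x) / 2` and `M 1|x = 1 - M 0|x`. -/
def noisyPauli (η : ℝ) (x : Fin 3) : Fin 2 → Matrix (Fin 2) (Fin 2) ℂ :=
  ![(1 / 2 : ℂ) • (1 + (η : ℂ) • pauli x), 1 - (1 / 2 : ℂ) • (1 + (η : ℂ) • pauli x)]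

/-! ### Statistics of a bipartite experiment

Alice has `m` settings, Bob has `n` settings, all outcomes are in `{0, 1}`. -/

/-- A table of probabilities: `joint a b x y = p(ab|xy)`, `alice a x = p(a|x)`,
`bob b y = p(b|y)`. -/
structure Behavior (m n : ℕ) where
  joint : Fin 2 → Fin 2 → Fin m → Fin n → ℝ
  alice : Fin 2 → Fin m → ℝ
  bob : Fin 2 → Fin n → ℝ

/-- `⟨A_x B_y⟩ = p(a = b|xy) - p(a ≠ b|xy)`. -/
def Behavior.corr {m n : ℕ} (p : Behavior m n) (x : Fin m) (y : Fin n) : ℝ :=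
  (p.joint 0 0 x y + p.joint 1 1 x y) - (p.joint 0 1 x y + p.joint 1 0 x y)

/-- `⟨A_x⟩ = p(0|x) - p(1|x)`. -/
def Behavior.meanA {m n : ℕ} (p : Behavior m n) (x : Fin m) : ℝ :=
  p.alice 0 x - p.alice 1 x

/-- `⟨B_y⟩ = p(0|y) - p(1|y)`. -/
def Behavior.meanB {m n : ℕ} (p : Behavior m n) (y : Fin n) : ℝ :=
  p.bob 0 y - p.bob 1 y

/-- The statistics of measurements `M` (Alice) and `N` (Bob) on the bipartite state `ρ`:
`p(ab|xy) = tr (ρ (M_{a|x} ⊗ N_{b|y}))`, with marginals `tr (ρ (M_{a|x} ⊗ 1))` and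
`tr (ρ (1 ⊗ N_{b|y}))`. -/
def quantumBehavior {m n dA dB : ℕ}
    (ρ : Matrix (Fin dA × Fin dB) (Fin dA × Fin dB) ℂ)
    (M : Fin m → Fin 2 → Matrix (Fin dA) (Fin dA) ℂ)
    (N : Fin n → Fin 2 → Matrix (Fin dB) (Fin dB) ℂ) : Behavior m n where
  joint a b x y := (ρ * (M x a ⊗ₖ N y b)).trace.re
  alice a x := (ρ * (M x a ⊗ₖ (1 : Matrix (Fin dB) (Fin dB) ℂ))).trace.re
  bob b y := (ρ * ((1 : Matrix (Fin dA) (Fin dA) ℂ) ⊗ₖ N y b)).trace.re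

/-- The statistics of a local hidden variable `l`, distributed according to `w`, with response
functions `pA l x a = p(a|x,l)` and `pB l y b = p(b|y,l)`. -/
def localBehavior {m n k : ℕ} (w : Fin k → ℝ) (pA : Fin k → Fin m → Fin 2 → ℝ)
    (pB : Fin k → Fin n → Fin 2 → ℝ) : Behavior m n where
  joint a b x y := ∑ l, w l * pA l x a * pB l y b
  alice a x := ∑ l, w l * pA l x a
  bob b y := ∑ l, w l * pB l y b

/-- Probability distributions on `Fin k`. -/
def IsProb {k : ℕ} (w : Fin k → ℝ) : Prop := (∀ l, 0 ≤ w l) ∧ ∑ l, w l = 1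

/-- Local behaviors: those reproduced by a hidden variable model. -/
def IsLocal {m n : ℕ} (p : Behavior m n) : Prop :=
  ∃ (k : ℕ) (w : Fin k → ℝ) (pA : Fin k → Fin m → Fin 2 → ℝ) (pB : Fin k → Fin n → Fin 2 → ℝ),
    IsProb w ∧ (∀ l x, IsProb (pA l x)) ∧ (∀ l y, IsProb (pB l y)) ∧
      p = localBehavior w pA pB

/-! ### Bell expressions -/

/-- The coefficients of a Bell expression with correlation terms `γ` and marginal terms
`α` (Alice) and `β` (Bob). -/
structure BellExpr (m n : ℕ) where
  γ : Fin m → Fin n → ℝ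
  α : Fin m → ℝ
  β : Fin n → ℝ

/-- `I = ∑ γ_{xy} ⟨A_x B_y⟩ + ∑ α_x ⟨A_x⟩ + ∑ β_y ⟨B_y⟩`. -/
def BellExpr.value {m n : ℕ} (I : BellExpr m n) (p : Behavior m n) : ℝ :=
  ∑ x, ∑ y, I.γ x y * p.corr x y + ∑ x, I.α x * p.meanA x + ∑ y, I.β y * p.meanB y

/-- `I ≤ 1` is a Bell inequality: it holds for all local behaviors. -/
def BellExpr.IsBellInequality {m n : ℕ} (I : BellExpr m n) : Prop :=
  ∀ p : Behavior m n, IsLocal p → I.value p ≤ 1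

/-- Full correlation expressions (XOR games): no marginal terms. -/
def BellExpr.IsFullCorrelation {m n : ℕ} (I : BellExpr m n) : Prop :=
  (∀ x, I.α x = 0) ∧ ∀ y, I.β y = 0

/-- The maximal value of `I` for qubit strategies: arbitrary two-qubit states and arbitrary
two-outcome POVMs on both qubits. (The values are bounded by the sum of the absolute values of
the coefficients, so that the supremum is a genuine one.) -/
def BellExpr.qubitMax {m n : ℕ} (I : BellExpr m n) : ℝ :=
  sSup {v : ℝ | ∃ (ρ : Matrix (Fin 2 × Fin 2) (Fin 2 × Fin 2) ℂ)
    (M : Fin m → Fin 2 → Matrix (Fin 2) (Fin 2) ℂ)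
    (N : Fin n → Fin 2 → Matrix (Fin 2) (Fin 2) ℂ),
    IsState ρ ∧ (∀ x, IsPOVM (M x)) ∧ (∀ y, IsPOVM (N y)) ∧
      v = I.value (quantumBehavior ρ M N)}

/-- Alice's measurements `M` can violate `I ≤ 1`: for some dimension of Bob's system, some shared
state and some two-outcome POVMs of Bob, the value of `I` exceeds `1`. -/
def CanViolate {m n dA : ℕ} (M : Fin m → Fin 2 → Matrix (Fin dA) (Fin dA) ℂ)
    (I : BellExpr m n) : Prop :=
  ∃ (dB : ℕ) (ρ : Matrix (Fin dA × Fin dB) (Fin dA × Fin dB) ℂ)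
    (N : Fin n → Fin 2 → Matrix (Fin dB) (Fin dB) ℂ),
    IsState ρ ∧ (∀ y, IsPOVM (N y)) ∧ 1 < I.value (quantumBehavior ρ M N)

/-! ### The Grothendieck constant of finite order -/

/-- The Grothendieck constant of order `d`: the supremum of `∑ c_{ij} ⟨u_i, v_j⟩` over unit
vectors of `ℝ^d` and over real matrices `c` of any size with `∑ c_{ij} s_i t_j ≤ 1` for all
signs. (The values are bounded by `d`, so that the supremum is a genuine one.) -/
def grothendieckConst (d : ℕ) : ℝ :=
  sSup {v : ℝ | ∃ (m n : ℕ) (c : Matrix (Fin m) (Fin n) ℝ)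
    (u : Fin m → EuclideanSpace ℝ (Fin d)) (w : Fin n → EuclideanSpace ℝ (Fin d)),
    (∀ (s : Fin m → ℝ) (t : Fin n → ℝ), (∀ i, s i = 1 ∨ s i = -1) →
      (∀ j, t j = 1 ∨ t j = -1) → ∑ i, ∑ j, c i j * (s i * t j) ≤ 1) ∧
    (∀ i, ‖u i‖ = 1) ∧ (∀ j, ‖w j‖ = 1) ∧
    v = ∑ i, ∑ j, c i j * inner ℝ (u i) (w j)}

end HollowTriangle

end

/-! Marginal terms: since `M 0|x - M 1|x = η σ_x`, the value at noise `η` is `η` times the value at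
`η = 1` plus `(1 - η) ∑ β_y ⟨B_y⟩`. The first value is at most `qubitMax` (`value_le_qubitMax`).
Bob's dimension is irrelevant there because the statistics depend only on the operators to which he
steers Alice's qubit, and a second qubit can produce the same operators. The second sum is at most
`∑ |β_y|`.

XOR games: the value is `η ∑_y ⟨(γ_y · σ) ⊗ B_y⟩ ≤ η ∑_y ‖γ_y‖`, where `γ_y` is the `y`-th column of
`γ`. The local bound, averaged over Alice's deterministic signs, combines with Khinchine's
inequality for three summands (`khinchine_three`) to give `∑_y ‖γ_y‖ ≤ √2`. Hence `η ≤ 1/√2`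
excludes violations. Both thresholds lie below `1/√2`, because `√2 ≤ K₃` (CHSH) and `√2 ≤ 1.5163`;
no upper bound on `K₃` is needed.

Hollow triangle: an explicit mother observable works for pairs when `2 η² ≤ 1`; for the triple, a
witness with operator norm `√3` forces `η ≤ 1/√3`. -/

namespace HollowTriangle

/-! ### Bilinear expectation values -/

/-- The trace of a product of two positive semidefinite matrices is nonnegative. -/
theorem trace_mul_nonneg {ι : Type*} [Fintype ι] [DecidableEq ι] {A B : Matrix ι ι ℂ}
    (hA : A.PosSemidef) (hB : B.PosSemidef) : 0 ≤ (A * B).trace := by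
  obtain ⟨C, rfl⟩ : ∃ C : Matrix ι ι ℂ, A = Cᴴ * C := by
    open scoped MatrixOrder in
    simpa [Matrix.star_eq_conjTranspose] using
      CStarAlgebra.nonneg_iff_eq_star_mul_self.mp hA.nonneg
  have h := (hB.mul_mul_conjTranspose_same C).trace_nonneg
  rwa [Matrix.mul_assoc, Matrix.trace_mul_comm]

/-- The expectation value `tr (ρ (A ⊗ B))`, its real part. -/
def expect {dA dB : ℕ} (ρ : Matrix (Fin dA × Fin dB) (Fin dA × Fin dB) ℂ)
    (A : Matrix (Fin dA) (Fin dA) ℂ) (B : Matrix (Fin dB) (Fin dB) ℂ) : ℝ :=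
  (ρ * (A ⊗ₖ B)).trace.re

section expect

variable {dA dB : ℕ} (ρ : Matrix (Fin dA × Fin dB) (Fin dA × Fin dB) ℂ)
  (A A' : Matrix (Fin dA) (Fin dA) ℂ) (B B' : Matrix (Fin dB) (Fin dB) ℂ)

theorem expect_add_left : expect ρ (A + A') B = expect ρ A B + expect ρ A' B := by
  simp [expect, Matrix.add_kronecker, Matrix.mul_add]

theorem expect_add_right : expect ρ A (B + B') = expect ρ A B + expect ρ A B' := by
  simp [expect, Matrix.kronecker_add, Matrix.mul_add]

theorem expect_smul_left (r : ℝ) : expect ρ ((r : ℂ) • A) B = r * expect ρ A B := by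
  simp [expect, Matrix.smul_kronecker]

theorem expect_neg_left : expect ρ (-A) B = -expect ρ A B := by
  simpa using expect_smul_left ρ A B (-1)

theorem expect_sub_left : expect ρ (A - A') B = expect ρ A B - expect ρ A' B := by
  rw [sub_eq_add_neg, expect_add_left, expect_neg_left, sub_eq_add_neg]

theorem expect_sub_right : expect ρ A (B - B') = expect ρ A B - expect ρ A B' := by
  have := expect_add_right ρ A (B - B') B'
  rw [sub_add_cancel] at this
  linarith

theorem expect_sum_left {ι : Type*} (s : Finset ι) (F : ι → Matrix (Fin dA) (Fin dA) ℂ) :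
    expect ρ (∑ i ∈ s, F i) B = ∑ i ∈ s, expect ρ (F i) B := by
  classical
  induction s using Finset.induction_on with
  | empty => simp [expect]
  | insert i s hi ih => rw [Finset.sum_insert hi, Finset.sum_insert hi, expect_add_left, ih]

variable {ρ A B}

theorem expect_nonneg (hρ : ρ.PosSemidef) (hA : A.PosSemidef) (hB : B.PosSemidef) :
    0 ≤ expect ρ A B :=
  (Complex.le_def.mp (trace_mul_nonneg hρ (hA.kronecker hB))).1

theorem expect_one_one (hρ : IsState ρ) : expect ρ 1 1 = 1 := by
  simp [expect, hρ.2]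

end expect

theorem IsPOVM.add_eq_one {ι : Type*} [Fintype ι] [DecidableEq ι] {M : Fin 2 → Matrix ι ι ℂ}
    (hM : IsPOVM M) : M 0 + M 1 = 1 := by
  simpa [Fin.sum_univ_two] using hM.2

/-- If `-g ≤ A ≤ g` then `⟨A ⊗ (N₀ - N₁)⟩ ≤ g` for every two-outcome POVM `N`. -/
theorem expect_le_of_posSemidef {dA dB : ℕ}
    {ρ : Matrix (Fin dA × Fin dB) (Fin dA × Fin dB) ℂ} (hρ : IsState ρ)
    {A : Matrix (Fin dA) (Fin dA) ℂ} {N : Fin 2 → Matrix (Fin dB) (Fin dB) ℂ} (hN : IsPOVM N)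
    {g : ℝ} (h₁ : ((g : ℂ) • 1 - A).PosSemidef) (h₂ : ((g : ℂ) • 1 + A).PosSemidef) :
    expect ρ A (N 0 - N 1) ≤ g := by
  have e₁ := expect_nonneg hρ.1 h₁ (hN.1 0)
  have e₂ := expect_nonneg hρ.1 h₂ (hN.1 1)
  rw [expect_sub_left, expect_smul_left] at e₁
  rw [expect_add_left, expect_smul_left] at e₂
  have e₃ : expect ρ 1 (N 0) + expect ρ 1 (N 1) = 1 := by
    rw [← expect_add_right, hN.add_eq_one, expect_one_one hρ]
  have e₄ : g * expect ρ 1 (N 0) + g * expect ρ 1 (N 1) = g := by rw [← mul_add, e₃, mul_one]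
  rw [expect_sub_right]
  linarith

theorem posSemidef_one_sub_and_one_add {ι : Type*} [Fintype ι] [DecidableEq ι]
    {M : Fin 2 → Matrix ι ι ℂ} (hM : IsPOVM M) :
    (((1 : ℝ) : ℂ) • 1 - (M 0 - M 1)).PosSemidef ∧ (((1 : ℝ) : ℂ) • 1 + (M 0 - M 1)).PosSemidef := by
  have h := hM.add_eq_one
  have h₁ : ((1 : ℝ) : ℂ) • (1 : Matrix ι ι ℂ) - (M 0 - M 1) = M 1 + M 1 := by
    rw [← h]; simp
  have h₂ : ((1 : ℝ) : ℂ) • (1 : Matrix ι ι ℂ) + (M 0 - M 1) = M 0 + M 0 := by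
    rw [← h]; simp
  rw [h₁, h₂]
  exact ⟨(hM.1 1).add (hM.1 1), (hM.1 0).add (hM.1 0)⟩

theorem IsPOVM.swap {ι : Type*} [Fintype ι] [DecidableEq ι] {N : Fin 2 → Matrix ι ι ℂ}
    (hN : IsPOVM N) : IsPOVM ![N 1, N 0] := by
  refine ⟨fun a => ?_, ?_⟩
  · fin_cases a
    · exact hN.1 1
    · exact hN.1 0
  · simpa [Fin.sum_univ_two, add_comm] using hN.add_eq_one

theorem abs_expect_le_of_posSemidef {dA dB : ℕ}
    {ρ : Matrix (Fin dA × Fin dB) (Fin dA × Fin dB) ℂ} (hρ : IsState ρ)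
    {A : Matrix (Fin dA) (Fin dA) ℂ} {N : Fin 2 → Matrix (Fin dB) (Fin dB) ℂ} (hN : IsPOVM N)
    {g : ℝ} (h₁ : ((g : ℂ) • 1 - A).PosSemidef) (h₂ : ((g : ℂ) • 1 + A).PosSemidef) :
    |expect ρ A (N 0 - N 1)| ≤ g := by
  have e₁ := expect_le_of_posSemidef hρ hN h₁ h₂
  -- Swapping Bob's outcomes flips the sign of the correlator.
  have e₂ := expect_le_of_posSemidef hρ hN.swap h₁ h₂
  simp only [Matrix.cons_val_zero, Matrix.cons_val_one, expect_sub_right] at e₁ e₂ ⊢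
  rw [abs_le]
  constructor <;> linarith

/-- The value of a Bell expression in terms of expectation values. -/
theorem value_quantumBehavior {m n dA dB : ℕ} (I : BellExpr m n)
    (ρ : Matrix (Fin dA × Fin dB) (Fin dA × Fin dB) ℂ)
    (M : Fin m → Fin 2 → Matrix (Fin dA) (Fin dA) ℂ)
    (N : Fin n → Fin 2 → Matrix (Fin dB) (Fin dB) ℂ) :
    I.value (quantumBehavior ρ M N) =
      ∑ x, ∑ y, I.γ x y * expect ρ (M x 0 - M x 1) (N y 0 - N y 1) +
        ∑ x, I.α x * expect ρ (M x 0 - M x 1) 1 + ∑ y, I.β y * expect ρ 1 (N y 0 - N y 1) := by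
  have hc : ∀ x y, (quantumBehavior ρ M N).corr x y =
      expect ρ (M x 0 - M x 1) (N y 0 - N y 1) := by
    intro x y
    simp only [expect_sub_left, expect_sub_right]
    simp only [Behavior.corr, quantumBehavior, expect]
    ring
  have ha : ∀ x, (quantumBehavior ρ M N).meanA x = expect ρ (M x 0 - M x 1) 1 := by
    intro x
    rw [expect_sub_left]; rfl
  have hb : ∀ y, (quantumBehavior ρ M N).meanB y = expect ρ 1 (N y 0 - N y 1) := by
    intro y
    rw [expect_sub_right]; rfl
  simp only [BellExpr.value, hc, ha, hb]

/-- The trivial measurement has effect difference `1`, so marginal terms become special cases of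
correlators. -/
theorem isPOVM_one_zero {ι : Type*} [Fintype ι] [DecidableEq ι] :
    IsPOVM ![(1 : Matrix ι ι ℂ), 0] := by
  refine ⟨fun a => ?_, by simp [Fin.sum_univ_two]⟩
  fin_cases a
  · exact Matrix.PosSemidef.one
  · exact Matrix.PosSemidef.zero

theorem posSemidef_one_smul_one {ι : Type*} [Fintype ι] [DecidableEq ι] :
    (((1 : ℝ) : ℂ) • (1 : Matrix ι ι ℂ) - 1).PosSemidef ∧
      (((1 : ℝ) : ℂ) • (1 : Matrix ι ι ℂ) + 1).PosSemidef := by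
  simpa using posSemidef_one_sub_and_one_add (isPOVM_one_zero (ι := ι))

theorem abs_expect_one_le {dA dB : ℕ}
    {ρ : Matrix (Fin dA × Fin dB) (Fin dA × Fin dB) ℂ} (hρ : IsState ρ)
    {N : Fin 2 → Matrix (Fin dB) (Fin dB) ℂ} (hN : IsPOVM N) :
    |expect ρ 1 (N 0 - N 1)| ≤ 1 :=
  abs_expect_le_of_posSemidef hρ hN posSemidef_one_smul_one.1 posSemidef_one_smul_one.2

/-- Quantum values of a Bell expression are bounded by the sum of the absolute values of its
coefficients. -/
theorem value_quantumBehavior_le {m n dA dB : ℕ} (I : BellExpr m n)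
    {ρ : Matrix (Fin dA × Fin dB) (Fin dA × Fin dB) ℂ} (hρ : IsState ρ)
    {M : Fin m → Fin 2 → Matrix (Fin dA) (Fin dA) ℂ} (hM : ∀ x, IsPOVM (M x))
    {N : Fin n → Fin 2 → Matrix (Fin dB) (Fin dB) ℂ} (hN : ∀ y, IsPOVM (N y)) :
    I.value (quantumBehavior ρ M N) ≤
      ∑ x, ∑ y, |I.γ x y| + ∑ x, |I.α x| + ∑ y, |I.β y| := by
  have key : ∀ c e : ℝ, |e| ≤ 1 → c * e ≤ |c| := fun c e he =>
    (le_abs_self _).trans (by rw [abs_mul]; exact mul_le_of_le_one_right (abs_nonneg c) he)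
  rw [value_quantumBehavior]
  refine add_le_add (add_le_add ?_ ?_) ?_
  · refine Finset.sum_le_sum fun x _ => Finset.sum_le_sum fun y _ => key _ _ ?_
    exact abs_expect_le_of_posSemidef hρ (hN y) (posSemidef_one_sub_and_one_add (hM x)).1
      (posSemidef_one_sub_and_one_add (hM x)).2
  · refine Finset.sum_le_sum fun x _ => key _ _ ?_
    simpa using abs_expect_le_of_posSemidef hρ isPOVM_one_zero (posSemidef_one_sub_and_one_add (hM x)).1
      (posSemidef_one_sub_and_one_add (hM x)).2
  · exact Finset.sum_le_sum fun y _ => key _ _ (abs_expect_one_le hρ (hN y))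

theorem le_qubitMax {m n : ℕ} (I : BellExpr m n)
    {ρ : Matrix (Fin 2 × Fin 2) (Fin 2 × Fin 2) ℂ} (hρ : IsState ρ)
    {M : Fin m → Fin 2 → Matrix (Fin 2) (Fin 2) ℂ} (hM : ∀ x, IsPOVM (M x))
    {N : Fin n → Fin 2 → Matrix (Fin 2) (Fin 2) ℂ} (hN : ∀ y, IsPOVM (N y)) :
    I.value (quantumBehavior ρ M N) ≤ I.qubitMax := by
  refine le_csSup ⟨∑ x, ∑ y, |I.γ x y| + ∑ x, |I.α x| + ∑ y, |I.β y|, ?_⟩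
    ⟨ρ, M, N, hρ, hM, hN, rfl⟩
  rintro _ ⟨ρ, M, N, hρ, hM, hN, rfl⟩
  exact value_quantumBehavior_le I hρ hM hN

/-! ### Reduction to a qubit on Bob's side -/

/-- The operator `tr_B (ρ (1 ⊗ N))` to which the effect `N` of Bob steers Alice's system. -/
def steered {dA dB : ℕ} (ρ : Matrix (Fin dA × Fin dB) (Fin dA × Fin dB) ℂ)
    (N : Matrix (Fin dB) (Fin dB) ℂ) : Matrix (Fin dA) (Fin dA) ℂ :=
  Matrix.of fun i j => ∑ k, ∑ l, ρ (i, k) (j, l) * N l k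

section steered

variable {dA dB : ℕ} {ρ : Matrix (Fin dA × Fin dB) (Fin dA × Fin dB) ℂ}
  {N : Matrix (Fin dB) (Fin dB) ℂ}

theorem trace_mul_kronecker (A : Matrix (Fin dA) (Fin dA) ℂ) :
    (ρ * (A ⊗ₖ N)).trace = (steered ρ N * A).trace := by
  simp only [Matrix.trace, Matrix.diag_apply, Matrix.mul_apply, Fintype.sum_prod_type, steered,
    Matrix.of_apply, Matrix.kronecker_apply, Finset.sum_mul]
  refine Finset.sum_congr rfl fun i _ => ?_
  rw [Finset.sum_comm]
  refine Finset.sum_congr rfl fun j _ => Finset.sum_congr rfl fun k _ =>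
    Finset.sum_congr rfl fun l _ => ?_
  ring

theorem expect_eq_steered (A : Matrix (Fin dA) (Fin dA) ℂ) :
    expect ρ A N = (steered ρ N * A).trace.re := by
  rw [expect, trace_mul_kronecker]

theorem steered_add (N N' : Matrix (Fin dB) (Fin dB) ℂ) :
    steered ρ (N + N') = steered ρ N + steered ρ N' := by
  ext i j
  simp [steered, mul_add, Finset.sum_add_distrib]

theorem steered_posSemidef (hρ : ρ.PosSemidef) (hN : N.PosSemidef) :
    (steered ρ N).PosSemidef := by
  refine Matrix.PosSemidef.of_dotProduct_mulVec_nonneg ?_ fun x => ?_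
  · ext i j
    simp only [Matrix.conjTranspose_apply, steered, Matrix.of_apply, star_sum, star_mul']
    rw [Finset.sum_comm]
    refine Finset.sum_congr rfl fun l _ => Finset.sum_congr rfl fun k _ => ?_
    rw [hρ.1.apply, hN.1.apply]
  -- The quadratic form of `steered ρ N` at `x` is `tr (ρ (x x† ⊗ N))`.
  · have h := trace_mul_nonneg hρ ((Matrix.posSemidef_vecMulVec_self_star x).kronecker hN)
    rwa [trace_mul_kronecker, Matrix.mul_vecMulVec, Matrix.trace_vecMulVec,
      dotProduct_comm] at h

theorem trace_steered_one : (steered ρ 1).trace = ρ.trace := by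
  have h := trace_mul_kronecker (ρ := ρ) (N := 1) 1
  rw [Matrix.one_kronecker_one, mul_one, mul_one] at h
  exact h.symm

/-- The statistics of an assemblage with an invertible reduced state are obtained from a
two-qudit state, Bob's system having the dimension of Alice's. -/
theorem exists_qudit_realization {n : ℕ} (hρ : IsState ρ) (hR : (steered ρ 1).PosDef)
    {N : Fin n → Fin 2 → Matrix (Fin dB) (Fin dB) ℂ} (hN : ∀ y, IsPOVM (N y)) :
    ∃ (ρ' : Matrix (Fin dA × Fin dA) (Fin dA × Fin dA) ℂ)
      (N' : Fin n → Fin 2 → Matrix (Fin dA) (Fin dA) ℂ),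
      IsState ρ' ∧ (∀ y, IsPOVM (N' y)) ∧ steered ρ' 1 = steered ρ 1 ∧
        ∀ y b, steered ρ' (N' y b) = steered ρ (N y b) := by
  obtain ⟨C, hC⟩ : ∃ C : Matrix (Fin dA) (Fin dA) ℂ, steered ρ 1 = Cᴴ * C := by
    open scoped MatrixOrder in
    simpa [Matrix.star_eq_conjTranspose] using
      CStarAlgebra.nonneg_iff_eq_star_mul_self.mp hR.posSemidef.nonneg
  have hu : IsUnit C.det := by
    have h := (Matrix.isUnit_iff_isUnit_det _).mp hR.isUnit
    rw [hC, Matrix.det_mul] at h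
    exact isUnit_of_mul_isUnit_right h
  have hu' : IsUnit Cᴴ.det := by rw [Matrix.det_conjTranspose]; exact hu.star
  -- The vectorisation of `Cᴴ` purifies Alice's reduced state `Cᴴ * C`; an effect `K` on the
  -- purifying side steers to `Cᴴ * Kᵀ * C`.
  let ψ : Fin dA × Fin dA → ℂ := fun p => Cᴴ p.1 p.2
  let ρ' := Matrix.vecMulVec ψ (star ψ)
  have hst : ∀ K : Matrix (Fin dA) (Fin dA) ℂ, steered ρ' K = Cᴴ * Kᵀ * C := by
    intro K
    ext i j
    simp only [steered, Matrix.of_apply, ρ', ψ, Matrix.vecMulVec_apply, Pi.star_apply,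
      Matrix.mul_apply, Matrix.transpose_apply, Matrix.conjTranspose_apply, star_star,
      Finset.sum_mul]
    rw [Finset.sum_comm]
    refine Finset.sum_congr rfl fun l _ => Finset.sum_congr rfl fun k _ => ?_
    ring
  have hst1 : steered ρ' 1 = steered ρ 1 := by rw [hst, hC]; simp
  -- Solution of `Cᴴ * (E K)ᵀ * C = steered ρ K`; this is where invertibility of the reduced state
  -- enters.
  let E : Matrix (Fin dB) (Fin dB) ℂ → Matrix (Fin dA) (Fin dA) ℂ :=
    fun K => (Cᴴ⁻¹ * steered ρ K * C⁻¹)ᵀ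
  refine ⟨ρ', fun y b => E (N y b), ⟨Matrix.posSemidef_vecMulVec_self_star ψ, ?_⟩,
    fun y => ⟨fun b => ?_, ?_⟩, hst1, fun y b => ?_⟩
  · rw [← trace_steered_one, hst1, trace_steered_one, hρ.2]
  · have h := (steered_posSemidef hρ.1 ((hN y).1 b)).conjTranspose_mul_mul_same C⁻¹
    rw [Matrix.conjTranspose_nonsing_inv] at h
    exact h.transpose
  · rw [Fin.sum_univ_two, ← Matrix.transpose_add, ← Matrix.add_mul, ← Matrix.mul_add,
      ← steered_add, (hN y).add_eq_one, hC, ← Matrix.mul_assoc, Matrix.nonsing_inv_mul _ hu',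
      Matrix.one_mul, Matrix.mul_nonsing_inv _ hu, Matrix.transpose_one]
  · rw [hst]
    simp only [E, Matrix.transpose_transpose]
    rw [Matrix.mul_assoc, Matrix.mul_assoc, Matrix.nonsing_inv_mul _ hu, Matrix.mul_one,
      ← Matrix.mul_assoc, Matrix.mul_nonsing_inv _ hu', Matrix.one_mul]

end steered

theorem value_eq_of_steered_eq {m n dA dB dB' : ℕ} (I : BellExpr m n)
    {ρ : Matrix (Fin dA × Fin dB) (Fin dA × Fin dB) ℂ}
    {ρ' : Matrix (Fin dA × Fin dB') (Fin dA × Fin dB') ℂ}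
    (M : Fin m → Fin 2 → Matrix (Fin dA) (Fin dA) ℂ)
    {N : Fin n → Fin 2 → Matrix (Fin dB) (Fin dB) ℂ}
    {N' : Fin n → Fin 2 → Matrix (Fin dB') (Fin dB') ℂ}
    (h₁ : steered ρ' 1 = steered ρ 1) (h : ∀ y b, steered ρ' (N' y b) = steered ρ (N y b)) :
    I.value (quantumBehavior ρ' M N') = I.value (quantumBehavior ρ M N) := by
  have e : ∀ A y b, expect ρ' A (N' y b) = expect ρ A (N y b) := fun A y b => by
    rw [expect_eq_steered, expect_eq_steered, h]
  have e₁ : ∀ A, expect ρ' A 1 = expect ρ A 1 := fun A => by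
    rw [expect_eq_steered, expect_eq_steered, h₁]
  simp only [value_quantumBehavior, expect_sub_right, e, e₁]

/-- Qubit measurements of Alice reach at most the qubit maximum, whatever Bob's dimension, if the
reduced state of Alice is invertible. -/
theorem value_le_qubitMax_of_posDef {m n dB : ℕ} (I : BellExpr m n)
    {ρ : Matrix (Fin 2 × Fin dB) (Fin 2 × Fin dB) ℂ} (hρ : IsState ρ)
    (hR : (steered ρ 1).PosDef)
    {M : Fin m → Fin 2 → Matrix (Fin 2) (Fin 2) ℂ} (hM : ∀ x, IsPOVM (M x))
    {N : Fin n → Fin 2 → Matrix (Fin dB) (Fin dB) ℂ} (hN : ∀ y, IsPOVM (N y)) :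
    I.value (quantumBehavior ρ M N) ≤ I.qubitMax := by
  obtain ⟨ρ', N', hρ', hN', h₁, h⟩ := exists_qudit_realization hρ hR hN
  rw [← value_eq_of_steered_eq I M h₁ h]
  exact le_qubitMax I hρ' hM hN'

theorem expect_mix {dA dB : ℕ} (ρ τ : Matrix (Fin dA × Fin dB) (Fin dA × Fin dB) ℂ) (a b : ℝ)
    (A : Matrix (Fin dA) (Fin dA) ℂ) (B : Matrix (Fin dB) (Fin dB) ℂ) :
    expect ((a : ℂ) • ρ + (b : ℂ) • τ) A B = a * expect ρ A B + b * expect τ A B := by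
  simp [expect, Matrix.add_mul]

theorem value_mix {m n dA dB : ℕ} (I : BellExpr m n)
    (ρ τ : Matrix (Fin dA × Fin dB) (Fin dA × Fin dB) ℂ) (a b : ℝ)
    (M : Fin m → Fin 2 → Matrix (Fin dA) (Fin dA) ℂ)
    (N : Fin n → Fin 2 → Matrix (Fin dB) (Fin dB) ℂ) :
    I.value (quantumBehavior ((a : ℂ) • ρ + (b : ℂ) • τ) M N) =
      a * I.value (quantumBehavior ρ M N) + b * I.value (quantumBehavior τ M N) := by
  simp only [value_quantumBehavior, expect_mix, mul_add, Finset.mul_sum, Finset.sum_add_distrib,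
    mul_left_comm _ a, mul_left_comm _ b]
  ring

theorem steered_mix {dA dB : ℕ} (ρ τ : Matrix (Fin dA × Fin dB) (Fin dA × Fin dB) ℂ) (a b : ℂ)
    (K : Matrix (Fin dB) (Fin dB) ℂ) :
    steered (a • ρ + b • τ) K = a • steered ρ K + b • steered τ K := by
  ext i j
  simp [steered, add_mul, Finset.sum_add_distrib, Finset.mul_sum, mul_assoc]

/-- White noise on both systems. -/
noncomputable def whiteNoise (dA dB : ℕ) : Matrix (Fin dA × Fin dB) (Fin dA × Fin dB) ℂ :=
  (((dA : ℂ) * dB)⁻¹) • 1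

theorem whiteNoise_isState {dA dB : ℕ} (hA : dA ≠ 0) (hB : dB ≠ 0) :
    IsState (whiteNoise dA dB) := by
  constructor
  · refine Matrix.PosSemidef.one.smul ?_
    have : ((dA : ℂ) * dB)⁻¹ = (((dA : ℝ) * dB)⁻¹ : ℝ) := by push_cast; rfl
    rw [this]
    exact_mod_cast (by positivity : (0 : ℝ) ≤ ((dA : ℝ) * dB)⁻¹)
  · have : (dA : ℂ) * dB ≠ 0 := by exact_mod_cast mul_ne_zero hA hB
    simp [whiteNoise]
    field_simp

theorem steered_whiteNoise_posDef {dA dB : ℕ} (hA : dA ≠ 0) (hB : dB ≠ 0) :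
    (steered (whiteNoise dA dB) 1).PosDef := by
  have : steered (whiteNoise dA dB) 1 = (((dA : ℝ)⁻¹ : ℝ) : ℂ) • 1 := by
    have hB' : (dB : ℂ) ≠ 0 := by exact_mod_cast hB
    ext i j
    by_cases hij : i = j
    · subst hij
      simp [steered, whiteNoise, Matrix.one_apply]
      field_simp
    · simp [steered, whiteNoise, Matrix.one_apply, hij]
  rw [this]
  refine Matrix.PosDef.one.smul ?_
  exact_mod_cast (by positivity : (0 : ℝ) < (dA : ℝ)⁻¹)

/-- This is the limit `ε → 0`. It removes the invertibility assumption after an admixture of white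
noise. -/
theorem le_of_forall_mix_le {a c K : ℝ} (h : ∀ ε : ℝ, 0 < ε → ε < 1 → (1 - ε) * a + ε * c ≤ K) :
    a ≤ K := by
  by_contra! hlt
  have hp : 0 < (a - K) + |a - c| + 1 := by positivity
  -- This `ε` makes `ε |a - c|` smaller than `a - K`, so the mixture still exceeds `K`.
  have hε : 0 < (a - K) / ((a - K) + |a - c| + 1) / 2 := by
    have : 0 < a - K := by linarith
    positivity
  set ε := (a - K) / ((a - K) + |a - c| + 1) / 2 with hdef
  have hmul : 2 * ε * ((a - K) + |a - c| + 1) = a - K := by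
    rw [hdef]; field_simp
  have h₁ : ε < 1 := by nlinarith [abs_nonneg (a - c)]
  have h₂ := h ε hε h₁
  nlinarith [le_abs_self (a - c), abs_nonneg (a - c)]

/-- Qubit measurements of Alice reach at most the qubit maximum, whatever Bob's dimension. -/
theorem value_le_qubitMax {m n dB : ℕ} (I : BellExpr m n)
    {ρ : Matrix (Fin 2 × Fin dB) (Fin 2 × Fin dB) ℂ} (hρ : IsState ρ)
    {M : Fin m → Fin 2 → Matrix (Fin 2) (Fin 2) ℂ} (hM : ∀ x, IsPOVM (M x))
    {N : Fin n → Fin 2 → Matrix (Fin dB) (Fin dB) ℂ} (hN : ∀ y, IsPOVM (N y)) :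
    I.value (quantumBehavior ρ M N) ≤ I.qubitMax := by
  -- In dimension zero the trace is `0`, so no state exists.
  have hB : dB ≠ 0 := by
    rintro rfl
    have := hρ.2
    simp [Matrix.trace] at this
  refine le_of_forall_mix_le (c := I.value (quantumBehavior (whiteNoise 2 dB) M N))
    fun ε h₀ h₁ => ?_
  have hw := whiteNoise_isState two_ne_zero hB
  have ha : (0 : ℂ) ≤ ((1 - ε : ℝ) : ℂ) := by exact_mod_cast (by linarith : (0 : ℝ) ≤ 1 - ε)
  have hb : (0 : ℂ) < (ε : ℂ) := by exact_mod_cast h₀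
  rw [← value_mix]
  refine value_le_qubitMax_of_posDef I ⟨(hρ.1.smul ha).add (hw.1.smul hb.le), ?_⟩ ?_ hM hN
  · simp [Matrix.trace_add, Matrix.trace_smul, hρ.2, hw.2]
  · rw [steered_mix]
    exact Matrix.PosDef.posSemidef_add ((steered_posSemidef hρ.1 Matrix.PosSemidef.one).smul ha)
      ((steered_whiteNoise_posDef two_ne_zero hB).smul hb)

/-! ### Pauli matrices -/

theorem pauli_isHermitian (x : Fin 3) : (pauli x).IsHermitian := by
  ext i j
  fin_cases x <;> fin_cases i <;> fin_cases j <;> simp [pauli]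

theorem pauli_mul_self (x : Fin 3) : pauli x * pauli x = 1 := by
  ext i j
  fin_cases x <;> fin_cases i <;> fin_cases j <;> simp [pauli]

/-- The matrix `v · σ`. -/
def pauliVec (v : Fin 3 → ℝ) : Matrix (Fin 2) (Fin 2) ℂ := ∑ x, (v x : ℂ) • pauli x

theorem pauliVec_isHermitian (v : Fin 3 → ℝ) : (pauliVec v)ᴴ = pauliVec v := by
  simp [pauliVec, Matrix.conjTranspose_sum, (pauli_isHermitian _).eq]

theorem pauliVec_mul_self (v : Fin 3 → ℝ) :
    pauliVec v * pauliVec v = ((∑ x, v x ^ 2 : ℝ) : ℂ) • 1 := by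
  ext i j
  fin_cases i <;> fin_cases j <;>
    simp [pauliVec, pauli, Fin.sum_univ_three, Matrix.mul_apply, Fin.sum_univ_two] <;>
    ring_nf <;> simp [Complex.I_sq]

theorem pauliVec_neg (v : Fin 3 → ℝ) : pauliVec (-v) = -pauliVec v := by
  simp [pauliVec]

theorem pauliVec_single (x : Fin 3) (c : ℝ) : pauliVec (Pi.single x c) = (c : ℂ) • pauli x := by
  unfold pauliVec
  rw [Finset.sum_eq_single x]
  · simp
  · intro b _ hb; simp [hb]
  · simp

theorem pauliVec_add (v w : Fin 3 → ℝ) : pauliVec (v + w) = pauliVec v + pauliVec w := by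
  simp [pauliVec, add_smul, Finset.sum_add_distrib]

theorem sum_sq_single (x : Fin 3) (c : ℝ) :
    ∑ i, (Pi.single x c : Fin 3 → ℝ) i ^ 2 = c ^ 2 := by
  fin_cases x <;> simp [Fin.sum_univ_three]

/-- `g + v · σ ≥ 0` as soon as `|v| ≤ g`. -/
theorem pauliVec_posSemidef {v : Fin 3 → ℝ} {g : ℝ} (hg : 0 ≤ g) (hv : ∑ x, v x ^ 2 ≤ g ^ 2) :
    ((g : ℂ) • 1 + pauliVec v).PosSemidef := by
  rcases hg.eq_or_lt with rfl | hg
  · have : v = 0 := by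
      have h0 : ∑ x, v x ^ 2 = 0 :=
        le_antisymm (by simpa using hv) (Finset.sum_nonneg fun x _ => sq_nonneg _)
      funext x
      simpa using (Finset.sum_eq_zero_iff_of_nonneg fun x _ => sq_nonneg (v x)).mp h0 x
    subst this
    simpa [pauliVec] using Matrix.PosSemidef.zero
  · set X := (g : ℂ) • (1 : Matrix (Fin 2) (Fin 2) ℂ) + pauliVec v with hX
    have hXX : Xᴴ * X = ((g ^ 2 + ∑ x, v x ^ 2 : ℝ) : ℂ) • 1 + ((2 * g : ℝ) : ℂ) • pauliVec v := by
      have hH : Xᴴ = X := by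
        simp [hX, pauliVec_isHermitian]
      rw [hH, hX]
      simp only [Matrix.add_mul, Matrix.mul_add, Matrix.smul_mul, Matrix.mul_smul, Matrix.one_mul,
        Matrix.mul_one, pauliVec_mul_self]
      push_cast
      module
    -- From `X² = g² + |v|² + 2 g v · σ` one gets `2 g X = X² + (g² - |v|²)`, a sum of positive
    -- terms. The division by `2 g` is why `g = 0` is treated apart.
    have hkey : X = (((2 * g)⁻¹ : ℝ) : ℂ) •
        (Xᴴ * X + ((g ^ 2 - ∑ x, v x ^ 2 : ℝ) : ℂ) • 1) := by
      have hg' : (g : ℂ) ≠ 0 := by exact_mod_cast hg.ne'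
      rw [hXX, hX]
      push_cast
      match_scalars <;> field_simp
      ring
    rw [hkey]
    refine ((Matrix.posSemidef_conjTranspose_mul_self X).add
      (Matrix.PosSemidef.one.smul ?_)).smul ?_
    · exact_mod_cast sub_nonneg.mpr hv
    · exact_mod_cast (by positivity : (0 : ℝ) ≤ (2 * g)⁻¹)

theorem pauliVec_posSemidef_sub {v : Fin 3 → ℝ} {g : ℝ} (hg : 0 ≤ g)
    (hv : ∑ x, v x ^ 2 ≤ g ^ 2) : ((g : ℂ) • 1 - pauliVec v).PosSemidef := by
  have := pauliVec_posSemidef (v := -v) hg (by simpa using hv)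
  rwa [pauliVec_neg, ← sub_eq_add_neg] at this

/-- The sign `(-1)^a` of the outcome `a`. -/
def outcomeSign : Fin 2 → ℝ := ![1, -1]

theorem outcomeSign_sq (a : Fin 2) : outcomeSign a ^ 2 = 1 := by
  fin_cases a <;> simp [outcomeSign]

theorem noisyPauli_eq (η : ℝ) (x : Fin 3) (a : Fin 2) :
    noisyPauli η x a = (1 / 2 : ℂ) • (1 + ((outcomeSign a * η : ℝ) : ℂ) • pauli x) := by
  fin_cases a
  · simp [noisyPauli, outcomeSign]
  · simp only [noisyPauli, outcomeSign, Fin.mk_one, Matrix.cons_val_one, Matrix.cons_val_fin_one]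
    push_cast
    module

theorem noisyPauli_sub (η : ℝ) (x : Fin 3) :
    noisyPauli η x 0 - noisyPauli η x 1 = (η : ℂ) • pauli x := by
  simp only [noisyPauli, Matrix.cons_val_zero, Matrix.cons_val_one, Matrix.cons_val_fin_one]
  module

theorem noisyPauli_isPOVM {η : ℝ} (h₀ : 0 ≤ η) (h₁ : η ≤ 1) (x : Fin 3) :
    IsPOVM (noisyPauli η x) := by
  refine ⟨fun a => ?_, by simp [noisyPauli, Fin.sum_univ_two]⟩
  rw [noisyPauli_eq, ← pauliVec_single]
  have h := pauliVec_posSemidef (v := Pi.single x (outcomeSign a * η)) zero_le_one (by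
    rw [sum_sq_single, mul_pow, outcomeSign_sq]; nlinarith)
  rw [Complex.ofReal_one, one_smul] at h
  refine h.smul ?_
  norm_num [Complex.le_def]

/-! ### Joint measurability of the noisy Pauli measurements -/

theorem noisyPauli_pair_jointlyMeasurable {η : ℝ} (hη : 2 * η ^ 2 ≤ 1) {x x' : Fin 3}
    (hx : x ≠ x') :
    JointlyMeasurable (fun i : Fin 2 => noisyPauli η (![x, x'] i)) := by
  -- The mother effects are `(1 ± η σ_x ± η σ_x') / 4`. Their Bloch vectors have squared length `2
  -- η²`, hence the hypothesis.
  let V : (Fin 2 → Fin 2) → Fin 3 → ℝ := fun f =>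
    Pi.single x (outcomeSign (f 0) * η) + Pi.single x' (outcomeSign (f 1) * η)
  have hV : ∀ f, ∑ i, V f i ^ 2 ≤ 1 ^ 2 := by
    intro f
    have h : ∑ i, V f i ^ 2 = (outcomeSign (f 0) * η) ^ 2 + (outcomeSign (f 1) * η) ^ 2 := by
      rw [← sum_sq_single x, ← sum_sq_single x', ← Finset.sum_add_distrib]
      refine Finset.sum_congr rfl fun i _ => ?_
      have : (Pi.single x (outcomeSign (f 0) * η) : Fin 3 → ℝ) i *
          (Pi.single x' (outcomeSign (f 1) * η) : Fin 3 → ℝ) i = 0 := by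
        by_cases h : i = x
        · subst h; simp [hx]
        · simp [h]
      simp only [V, Pi.add_apply, add_sq]
      linarith
    rw [h, mul_pow, mul_pow, outcomeSign_sq, outcomeSign_sq]
    linarith
  let G : (Fin 2 → Fin 2) → Matrix (Fin 2) (Fin 2) ℂ := fun f =>
    (1 / 4 : ℂ) • (((1 : ℝ) : ℂ) • 1 + pauliVec (V f))
  have hG : ∀ f, G f = (1 / 4 : ℂ) • (1 + ((outcomeSign (f 0) * η : ℝ) : ℂ) • pauli x +
      ((outcomeSign (f 1) * η : ℝ) : ℂ) • pauli x') := by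
    intro f
    simp only [G, V, pauliVec_add, pauliVec_single, Complex.ofReal_one, one_smul, add_assoc]
  have huniv : (Finset.univ : Finset (Fin 2 → Fin 2)) = {![0, 0], ![0, 1], ![1, 0], ![1, 1]} := by
    decide
  refine ⟨G, ⟨fun f => ?_, ?_⟩, fun i a => ?_⟩
  · refine (pauliVec_posSemidef zero_le_one (hV f)).smul ?_
    norm_num [Complex.le_def]
  · rw [huniv]
    simp [hG, outcomeSign]
    module
  · beta_reduce
    rw [noisyPauli_eq, Finset.sum_filter, huniv]
    fin_cases i <;> fin_cases a <;> simp [hG, outcomeSign] <;> module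

/-- Each mother effect `G f` is tested against `s_f · σ`, with `s_f` the sign vector of its
outcomes. The total is `∑_x tr (σ_x η σ_x) = 6 η`. Since `s_f · σ ≤ √3`, it is at most `√3 ∑ tr (G
f) = 2 √3`. -/
theorem noisyPauli_not_jointlyMeasurable {η : ℝ} (hη : 1 / Real.sqrt 3 < η) :
    ¬ JointlyMeasurable (noisyPauli η) := by
  rintro ⟨G, ⟨hG, hsum⟩, hmarg⟩
  have hdiff : ∀ x, ∑ f, ((outcomeSign (f x) : ℝ) : ℂ) • G f = (η : ℂ) • pauli x := by
    intro x
    rw [← noisyPauli_sub, ← Finset.sum_fiberwise Finset.univ (fun f : Fin 3 → Fin 2 => f x),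
      Fin.sum_univ_two, ← hmarg x 0, ← hmarg x 1, sub_eq_add_neg, ← Finset.sum_neg_distrib]
    congr 1 <;> refine Finset.sum_congr rfl fun f hf => ?_ <;>
      simp [(Finset.mem_filter.mp hf).2, outcomeSign]
  have hle : ∀ f, (pauliVec (fun x => outcomeSign (f x)) * G f).trace.re ≤
      Real.sqrt 3 * (G f).trace.re := by
    intro f
    have hps := pauliVec_posSemidef_sub (v := fun x => outcomeSign (f x)) (Real.sqrt_nonneg 3)
      (by simp [outcomeSign_sq])
    have := (Complex.le_def.mp (trace_mul_nonneg hps (hG f))).1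
    simpa [Matrix.sub_mul] using this
  have htot : ∑ f, (pauliVec (fun x => outcomeSign (f x)) * G f).trace = 6 * η := by
    have : ∀ f, pauliVec (fun x => outcomeSign (f x)) * G f =
        ∑ x, pauli x * (((outcomeSign (f x) : ℝ) : ℂ) • G f) := by
      intro f
      simp [pauliVec, Finset.sum_mul]
    simp only [this]
    rw [← Matrix.trace_sum, Finset.sum_comm]
    simp only [← Matrix.mul_sum, hdiff]
    simp only [Matrix.mul_smul, pauli_mul_self, Matrix.trace_smul,
      Matrix.trace_one, Finset.sum_const, Finset.card_univ, Fintype.card_fin]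
    simp only [smul_eq_mul, nsmul_eq_mul]
    push_cast
    ring
  have htr : ∑ f, (G f).trace = 2 := by
    rw [← Matrix.trace_sum, hsum]; simp
  have h1 : (6 : ℝ) * η ≤ Real.sqrt 3 * 2 := by
    have e1 : (6 : ℝ) * η = ∑ f, (pauliVec (fun x => outcomeSign (f x)) * G f).trace.re := by
      rw [← Complex.re_sum, htot]; simp
    have e2 : (2 : ℝ) = ∑ f, (G f).trace.re := by
      rw [← Complex.re_sum, htr]; simp
    rw [e1, e2, Finset.mul_sum]
    exact Finset.sum_le_sum fun f _ => hle f
  have h3 : 0 < Real.sqrt 3 := by positivity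
  rw [div_lt_iff₀ h3] at hη
  nlinarith [Real.sq_sqrt (show (0 : ℝ) ≤ 3 by norm_num)]

/-! ### Bell inequalities with small marginal terms -/

theorem value_noisyPauli {n dB : ℕ} (I : BellExpr 3 n) (η : ℝ)
    (ρ : Matrix (Fin 2 × Fin dB) (Fin 2 × Fin dB) ℂ)
    (N : Fin n → Fin 2 → Matrix (Fin dB) (Fin dB) ℂ) :
    I.value (quantumBehavior ρ (noisyPauli η) N) =
      η * I.value (quantumBehavior ρ (noisyPauli 1) N) +
        (1 - η) * ∑ y, I.β y * expect ρ 1 (N y 0 - N y 1) := by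
  simp only [value_quantumBehavior, noisyPauli_sub, expect_smul_left, mul_add, Finset.mul_sum,
    one_mul, mul_left_comm _ η, sub_mul, Finset.sum_sub_distrib]
  ring

theorem noisyPauli_not_canViolate_of_marginal_le {n : ℕ} (I : BellExpr 3 n) {η : ℝ} (h₀ : 0 ≤ η)
    (h₁ : η < 1) (hβ : ∑ y, |I.β y| ≤ (1 - η * I.qubitMax) / (1 - η)) :
    ¬ CanViolate (noisyPauli η) I := by
  rintro ⟨dB, ρ, N, hρ, hN, hviol⟩
  have hI := value_le_qubitMax I hρ (noisyPauli_isPOVM zero_le_one le_rfl) hN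
  have hB : ∑ y, I.β y * expect ρ 1 (N y 0 - N y 1) ≤ ∑ y, |I.β y| := by
    refine Finset.sum_le_sum fun y _ => (le_abs_self _).trans ?_
    rw [abs_mul]
    exact mul_le_of_le_one_right (abs_nonneg _) (abs_expect_one_le hρ (hN y))
  have hη : 0 < 1 - η := by linarith
  rw [le_div_iff₀ hη] at hβ
  rw [value_noisyPauli] at hviol
  nlinarith [mul_le_mul_of_nonneg_left hI h₀, mul_le_mul_of_nonneg_left hB hη.le]

/-! ### Full-correlation Bell inequalities -/

theorem exists_sign_mul_eq_abs (a : ℝ) : ∃ s : ℝ, (s = 1 ∨ s = -1) ∧ s * a = |a| := by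
  rcases abs_cases a with h | h
  · exact ⟨1, Or.inl rfl, by rw [h.1, one_mul]⟩
  · exact ⟨-1, Or.inr rfl, by rw [h.1]; ring⟩

/-- A full-correlation Bell inequality holds for deterministic strategies. -/
theorem BellExpr.IsBellInequality.sum_sign_le {m n : ℕ} {I : BellExpr m n}
    (hI : I.IsBellInequality) (hfull : I.IsFullCorrelation) {s : Fin m → ℝ} {t : Fin n → ℝ}
    (hs : ∀ x, s x = 1 ∨ s x = -1) (ht : ∀ y, t y = 1 ∨ t y = -1) :
    ∑ x, ∑ y, I.γ x y * (s x * t y) ≤ 1 := by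
  -- A sign `r` is the mean of the deterministic distribution `((1 + r) / 2, (1 - r) / 2)`.
  have hprob : ∀ r : ℝ, (r = 1 ∨ r = -1) → IsProb ![(1 + r) / 2, (1 - r) / 2] := by
    rintro r (rfl | rfl) <;> refine ⟨fun l => ?_, ?_⟩ <;>
      first | (fin_cases l <;> norm_num) | norm_num [Fin.sum_univ_two]
  have h := hI (localBehavior (k := 1) (fun _ => 1) (fun _ x => ![(1 + s x) / 2, (1 - s x) / 2])
    (fun _ y => ![(1 + t y) / 2, (1 - t y) / 2]))
    ⟨1, _, _, _, ⟨fun _ => zero_le_one, by simp⟩, fun _ x => hprob _ (hs x),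
      fun _ y => hprob _ (ht y), rfl⟩
  refine le_of_eq_of_le ?_ h
  simp only [BellExpr.value, hfull.1, hfull.2, zero_mul, Finset.sum_const_zero, add_zero]
  refine Finset.sum_congr rfl fun x _ => Finset.sum_congr rfl fun y _ => ?_
  simp only [Behavior.corr, localBehavior, Finset.univ_unique, Finset.sum_singleton,
    Matrix.cons_val_zero, Matrix.cons_val_one, Matrix.cons_val_fin_one]
  ring

theorem BellExpr.IsBellInequality.sum_abs_le {m n : ℕ} {I : BellExpr m n}
    (hI : I.IsBellInequality) (hfull : I.IsFullCorrelation) {s : Fin m → ℝ}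
    (hs : ∀ x, s x = 1 ∨ s x = -1) : ∑ y, |∑ x, I.γ x y * s x| ≤ 1 := by
  -- Bob's best deterministic reply to `s`.
  choose t ht hts using fun y => exists_sign_mul_eq_abs (∑ x, I.γ x y * s x)
  refine le_of_eq_of_le ?_ (hI.sum_sign_le hfull hs ht)
  rw [Finset.sum_comm]
  refine Finset.sum_congr rfl fun y _ => ?_
  rw [← hts, Finset.mul_sum]
  refine Finset.sum_congr rfl fun x _ => ?_
  ring

/-- Khinchine's inequality with the constant `1 / √2` for three summands. -/
theorem khinchine_three (a b c : ℝ) :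
    4 * Real.sqrt (a ^ 2 + b ^ 2 + c ^ 2) ≤
      Real.sqrt 2 * (|a + b + c| + |a + b - c| + |a - b + c| + |a - b - c|) := by
  set p := a + b + c with hp
  set q := a + b - c with hq
  set r := a - b + c with hr
  set t := a - b - c with ht
  -- Each of `p, q, r, t` is a signed sum of the other three, so its modulus is at most the sum of
  -- theirs. Multiplying by that modulus and adding the four bounds gives `2 ∑ |·|² ≤ (∑ |·|)²`,
  -- while `∑ |·|² = 4 (a² + b² + c²)`.
  have h4 : ∀ u v w : ℝ, |u + v - w| ≤ |u| + |v| + |w| := fun u v w =>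
    (abs_sub _ _).trans (add_le_add_left (abs_add_le u v) _)
  have e1 : |p| ≤ |q| + |r| + |t| := by
    have := h4 q r t; rwa [show q + r - t = p by rw [hp, hq, hr, ht]; ring] at this
  have e2 : |q| ≤ |p| + |t| + |r| := by
    have := h4 p t r; rwa [show p + t - r = q by rw [hp, hq, hr, ht]; ring] at this
  have e3 : |r| ≤ |p| + |t| + |q| := by
    have := h4 p t q; rwa [show p + t - q = r by rw [hp, hq, hr, ht]; ring] at this
  have e4 : |t| ≤ |q| + |r| + |p| := by
    have := h4 q r p; rwa [show q + r - p = t by rw [hp, hq, hr, ht]; ring] at this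
  have hsq : 4 * (a ^ 2 + b ^ 2 + c ^ 2) = |p| ^ 2 + |q| ^ 2 + |r| ^ 2 + |t| ^ 2 := by
    simp only [sq_abs, hp, hq, hr, ht]; ring
  have f1 := mul_le_mul_of_nonneg_left e1 (abs_nonneg p)
  have f2 := mul_le_mul_of_nonneg_left e2 (abs_nonneg q)
  have f3 := mul_le_mul_of_nonneg_left e3 (abs_nonneg r)
  have f4 := mul_le_mul_of_nonneg_left e4 (abs_nonneg t)
  refine abs_le_of_sq_le_sq' ?_ (by positivity) |>.2
  rw [mul_pow, mul_pow, Real.sq_sqrt (by positivity), Real.sq_sqrt (by norm_num)]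
  linarith

theorem BellExpr.IsBellInequality.sum_sqrt_le {n : ℕ} {I : BellExpr 3 n}
    (hI : I.IsBellInequality) (hfull : I.IsFullCorrelation) :
    ∑ y, Real.sqrt (∑ x, I.γ x y ^ 2) ≤ Real.sqrt 2 := by
  -- A global sign is irrelevant, so Alice's first sign is fixed to `1`. The four remaining choices
  -- are the four moduli in `khinchine_three`.
  have h : ∀ s₁ s₂ : ℝ, (s₁ = 1 ∨ s₁ = -1) → (s₂ = 1 ∨ s₂ = -1) →
      ∑ y, |I.γ 0 y + I.γ 1 y * s₁ + I.γ 2 y * s₂| ≤ 1 := by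
    intro s₁ s₂ h₁ h₂
    have hs : ∀ x, (![1, s₁, s₂] : Fin 3 → ℝ) x = 1 ∨ (![1, s₁, s₂] : Fin 3 → ℝ) x = -1 := by
      intro x
      fin_cases x
      · exact Or.inl rfl
      · exact h₁
      · exact h₂
    simpa [Fin.sum_univ_three] using hI.sum_abs_le hfull hs
  have h1 := h 1 1 (Or.inl rfl) (Or.inl rfl)
  have h2 := h 1 (-1) (Or.inl rfl) (Or.inr rfl)
  have h3 := h (-1) 1 (Or.inr rfl) (Or.inl rfl)
  have h4 := h (-1) (-1) (Or.inr rfl) (Or.inr rfl)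
  simp only [mul_one, mul_neg, ← sub_eq_add_neg] at h1 h2 h3 h4
  have hk := Finset.sum_le_sum fun y (_ : y ∈ Finset.univ) =>
    khinchine_three (I.γ 0 y) (I.γ 1 y) (I.γ 2 y)
  simp only [← Finset.mul_sum, Finset.sum_add_distrib] at hk
  simp only [Fin.sum_univ_three]
  nlinarith [Real.sqrt_nonneg 2]

theorem noisyPauli_not_canViolate_of_fullCorrelation {n : ℕ} {I : BellExpr 3 n} {η : ℝ}
    (h₀ : 0 ≤ η) (hη : Real.sqrt 2 * η ≤ 1) (hI : I.IsBellInequality)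
    (hfull : I.IsFullCorrelation) : ¬ CanViolate (noisyPauli η) I := by
  rintro ⟨dB, ρ, N, hρ, hN, hviol⟩
  have hval : I.value (quantumBehavior ρ (noisyPauli η) N) =
      η * ∑ y, expect ρ (pauliVec fun x => I.γ x y) (N y 0 - N y 1) := by
    simp only [value_quantumBehavior, noisyPauli_sub, expect_smul_left, hfull.1, hfull.2,
      zero_mul, Finset.sum_const_zero, add_zero, pauliVec, expect_sum_left, Finset.mul_sum]
    rw [Finset.sum_comm]
    refine Finset.sum_congr rfl fun y _ => Finset.sum_congr rfl fun x _ => ?_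
    ring
  have hle : ∑ y, expect ρ (pauliVec fun x => I.γ x y) (N y 0 - N y 1) ≤
      ∑ y, Real.sqrt (∑ x, I.γ x y ^ 2) := by
    refine Finset.sum_le_sum fun y _ => ?_
    have hs : ∑ x, I.γ x y ^ 2 ≤ Real.sqrt (∑ x, I.γ x y ^ 2) ^ 2 :=
      (Real.sq_sqrt (Finset.sum_nonneg fun x _ => sq_nonneg _)).ge
    exact expect_le_of_posSemidef hρ (hN y) (pauliVec_posSemidef_sub (Real.sqrt_nonneg _) hs)
      (pauliVec_posSemidef (Real.sqrt_nonneg _) hs)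
  have := mul_le_mul_of_nonneg_left (hle.trans (hI.sum_sqrt_le hfull)) h₀
  rw [hval] at hviol
  linarith

/-! ### The Grothendieck constant of order three -/

/-- A bilinear form on a product of cubes is maximal at vertices: first `x`, then `y`, is replaced
by optimal signs. -/
theorem sum_mul_le_of_abs_le_one {m n : ℕ} {c : Matrix (Fin m) (Fin n) ℝ}
    (hc : ∀ (s : Fin m → ℝ) (t : Fin n → ℝ), (∀ i, s i = 1 ∨ s i = -1) →
      (∀ j, t j = 1 ∨ t j = -1) → ∑ i, ∑ j, c i j * (s i * t j) ≤ 1)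
    {x : Fin m → ℝ} {y : Fin n → ℝ} (hx : ∀ i, |x i| ≤ 1) (hy : ∀ j, |y j| ≤ 1) :
    ∑ i, ∑ j, c i j * (x i * y j) ≤ 1 := by
  have key : ∀ r a : ℝ, |r| ≤ 1 → r * a ≤ |a| := fun r a hr =>
    (le_abs_self _).trans (by rw [abs_mul]; exact mul_le_of_le_one_left (abs_nonneg a) hr)
  choose s hs hsa using fun i => exists_sign_mul_eq_abs (∑ j, c i j * y j)
  choose t ht hta using fun j => exists_sign_mul_eq_abs (∑ i, c i j * s i)
  calc ∑ i, ∑ j, c i j * (x i * y j) = ∑ i, x i * ∑ j, c i j * y j := by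
        simp only [Finset.mul_sum]
        exact Finset.sum_congr rfl fun i _ => Finset.sum_congr rfl fun j _ => by ring
    _ ≤ ∑ i, s i * ∑ j, c i j * y j :=
        Finset.sum_le_sum fun i _ => (key _ _ (hx i)).trans (hsa i).ge
    _ = ∑ j, y j * ∑ i, c i j * s i := by
        simp only [Finset.mul_sum]
        rw [Finset.sum_comm]
        exact Finset.sum_congr rfl fun i _ => Finset.sum_congr rfl fun j _ => by ring
    _ ≤ ∑ j, t j * ∑ i, c i j * s i :=
        Finset.sum_le_sum fun j _ => (key _ _ (hy j)).trans (hta j).ge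
    _ = ∑ i, ∑ j, c i j * (s i * t j) := by
        simp only [Finset.mul_sum]
        rw [Finset.sum_comm]
        exact Finset.sum_congr rfl fun i _ => Finset.sum_congr rfl fun j _ => by ring
    _ ≤ 1 := hc s t hs ht

theorem le_grothendieckConst {d m n : ℕ} {c : Matrix (Fin m) (Fin n) ℝ}
    {u : Fin m → EuclideanSpace ℝ (Fin d)} {w : Fin n → EuclideanSpace ℝ (Fin d)}
    (hc : ∀ (s : Fin m → ℝ) (t : Fin n → ℝ), (∀ i, s i = 1 ∨ s i = -1) →
      (∀ j, t j = 1 ∨ t j = -1) → ∑ i, ∑ j, c i j * (s i * t j) ≤ 1)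
    (hu : ∀ i, ‖u i‖ = 1) (hw : ∀ j, ‖w j‖ = 1) :
    ∑ i, ∑ j, c i j * inner ℝ (u i) (w j) ≤ grothendieckConst d := by
  refine le_csSup ⟨d, ?_⟩ ⟨m, n, c, u, w, hc, hu, hw, rfl⟩
  rintro _ ⟨m, n, c, u, w, hc, hu, hw, rfl⟩
  have hcoord : ∀ v : EuclideanSpace ℝ (Fin d), ‖v‖ = 1 → ∀ k, |v k| ≤ 1 := fun v hv k => by
    have := PiLp.norm_apply_le v k
    rwa [hv, Real.norm_eq_abs] at this
  calc ∑ i, ∑ j, c i j * inner ℝ (u i) (w j)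
      -- Each coordinate of the unit vectors is a strategy with values in `[-1, 1]` and contributes
      -- at most `1`. The resulting bound `d` makes the supremum genuine.
      = ∑ k, ∑ i, ∑ j, c i j * (u i k * w j k) := by
        symm
        rw [Finset.sum_comm]
        refine Finset.sum_congr rfl fun i _ => ?_
        rw [Finset.sum_comm]
        refine Finset.sum_congr rfl fun j _ => ?_
        simp [PiLp.inner_apply, Finset.mul_sum, mul_comm]
    _ ≤ ∑ _k : Fin d, (1 : ℝ) := Finset.sum_le_sum fun k _ =>
        sum_mul_le_of_abs_le_one hc (fun i => hcoord _ (hu i) k) (fun j => hcoord _ (hw j) k)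
    _ = d := by simp

/-- The CHSH game shows `√2 ≤ K₃`. -/
theorem sqrt_two_le_grothendieckConst_three : Real.sqrt 2 ≤ grothendieckConst 3 := by
  have h2 : Real.sqrt 2 ^ 2 = 2 := Real.sq_sqrt (by norm_num)
  have h0 : Real.sqrt 2 ≠ 0 := by positivity
  -- CHSH scaled to local bound `1`, with the Tsirelson-optimal vectors in a plane.
  have h := le_grothendieckConst (d := 3) (c := !![1 / 2, 1 / 2; 1 / 2, -1 / 2])
    (u := ![!₂[1, 0, 0], !₂[0, 1, 0]])
    (w := ![!₂[1 / Real.sqrt 2, 1 / Real.sqrt 2, 0], !₂[1 / Real.sqrt 2, -(1 / Real.sqrt 2), 0]])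
    ?_ ?_ ?_
  · refine le_of_eq_of_le ?_ h
    simp [Fin.sum_univ_two, PiLp.inner_apply, Fin.sum_univ_three]
    field_simp
    rw [h2]; norm_num
  · intro s t hs ht
    simp only [Fin.sum_univ_two]
    rcases hs 0 with a | a <;> rcases hs 1 with b | b <;> rcases ht 0 with c | c <;>
      rcases ht 1 with d | d <;> norm_num [a, b, c, d]
  · intro i
    fin_cases i <;> simp [EuclideanSpace.norm_eq, Fin.sum_univ_three]
  · intro i
    fin_cases i <;> simp [EuclideanSpace.norm_eq, Fin.sum_univ_three] <;> norm_num

end HollowTriangle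

theorem mainTheorem2 :
    (∀ (n : ℕ) (I : HollowTriangle.BellExpr 3 n) (η : ℝ), 0 ≤ η → η < 1 →
      I.IsBellInequality →
      η * I.qubitMax ≤ 1 →
      ∑ y, |I.β y| ≤ (1 - η * I.qubitMax) / (1 - η) →
      ¬ HollowTriangle.CanViolate (HollowTriangle.noisyPauli η) I) ∧
    (∀ η : ℝ, 1 / Real.sqrt 3 < η →
      (η < 1 / HollowTriangle.grothendieckConst 3 ∨ η < 1 / 1.5163) →
      (∀ x, HollowTriangle.IsPOVM (HollowTriangle.noisyPauli η x)) ∧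
      (∀ x x' : Fin 3, x ≠ x' → HollowTriangle.JointlyMeasurable
        (fun i : Fin 2 => HollowTriangle.noisyPauli η (![x, x'] i))) ∧
      ¬ HollowTriangle.JointlyMeasurable (HollowTriangle.noisyPauli η) ∧
      ∀ (n : ℕ) (I : HollowTriangle.BellExpr 3 n),
        I.IsBellInequality → I.IsFullCorrelation →
        ¬ HollowTriangle.CanViolate (HollowTriangle.noisyPauli η) I) := by
  refine ⟨fun n I η h₀ h₁ _ _ hβ =>
    HollowTriangle.noisyPauli_not_canViolate_of_marginal_le I h₀ h₁ hβ, fun η hη hK => ?_⟩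
  have h₀ : 0 < η := lt_trans (by positivity) hη
  have hs : 0 < Real.sqrt 2 := by positivity
  have h2 : Real.sqrt 2 ^ 2 = 2 := Real.sq_sqrt (by norm_num)
  have hlt : η < 1 / Real.sqrt 2 := by
    rcases hK with h | h
    · exact h.trans_le
        (one_div_le_one_div_of_le hs HollowTriangle.sqrt_two_le_grothendieckConst_three)
    · refine h.trans_le (one_div_le_one_div_of_le hs ?_)
      rw [Real.sqrt_le_left (by norm_num)]
      norm_num
  rw [lt_div_iff₀ hs] at hlt
  have hsq : 2 * η ^ 2 ≤ 1 := by
    have : (η * Real.sqrt 2) ^ 2 ≤ 1 := pow_le_one₀ (by positivity) hlt.le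
    rw [mul_pow, h2] at this
    linarith
  exact ⟨HollowTriangle.noisyPauli_isPOVM h₀.le (by nlinarith),
    fun x x' hx => HollowTriangle.noisyPauli_pair_jointlyMeasurable hsq hx,
    HollowTriangle.noisyPauli_not_jointlyMeasurable hη,
    fun n I hI hfull => HollowTriangle.noisyPauli_not_canViolate_of_fullCorrelation h₀.le
      (by linarith) hI hfull⟩
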